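/- All Lie groups are real, smooth and finite-dimensional; $[x,y]$ denotes $xyx^{-1}y^{-1}$ in a group and the Lie bracket in a Lie algebra; the Lie algebra of a Lie group is its tangent space at $1$ with the bracket of left-invariant vector fields. Lie algebras are over $\mathbb R$. **2-crossed modules of Lie groups.** A 2-crossed module $\mathcal H=(L\xrightarrow{\delta}E\xrightarrow{\partial}G,\triangleright,\{,\})$ of Lie groups consists of smooth group homomorphisms $\delta,\partial$ between Lie groups, smooth left actions $\triangleright$ of $G$ on $L$ and on $E$ by automorphisms, and a smooth map $\{,\}\colon E\times E\to L$ (the Peiffer lifting) with $g\triangleright\{e,f\}=\{g\triangleright e,g\triangleright f\}$, such that, for $g\in G$, $e,f,h\in E$, $l,k\in L$ and $\langle e,f\rangle:=efe^{-1}\,(\partial(e)\triangleright f^{-1})$: 1. $\partial\delta=1$, $\delta(g\triangleright l)=g\triangleright\delta(l)$ and $\partial(g\triangleright e)=g\,\partial(e)\,g^{-1}$; 2. $\delta\{e,f\}=\langle e,f\rangle$; 3. $[l,k]=\{\delta(l),\delta(k)\}$; 4. $\{ef,h\}=\{e,fhf^{-1}\}\,\bigl(\partial(e)\triangleright\{f,h\}\bigr)$;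 5. $\{e,fh\}=\{e,f\}\,\{e,h\}\,\bigl\{\langle e,h\rangle^{-1},\partial(e)\triangleright f\bigr\}$; 6. $\{\delta(l),e\}\,\{e,\delta(l)\}=l\,\bigl(\partial(e)\triangleright l^{-1}\bigr)$. A morphism $\mathcal H\to\mathcal H'$ is a triple of smooth homomorphisms $L\to L'$, $E\to E'$, $G\to G'$ compatible with $\delta$, $\partial$, both actions and the Peiffer liftings. **Differential 2-crossed modules.** A differential 2-crossed module $(\mathfrak l\xrightarrow{\delta}\mathfrak e\xrightarrow{\partial}\mathfrak g,\triangleright,\{,\})$ consists of Lie algebra homomorphisms $\delta,\partial$, left actions $\triangleright$ of the Lie algebra $\mathfrak g$ on $\mathfrak l$ and on $\mathfrak e$ by derivations, and a bilinear map $\{,\}\colon\mathfrak e\times\mathfrak e\to\mathfrak l$ with $X\triangleright\{u,v\}=\{X\triangleright u,v\}+\{u,X\triangleright v\}$, such that, for $X\in\mathfrak g$, $u,v,w\in\mathfrak e$ and $x,y\in\mathfrak l$: 1. $\partial\delta=0$, $\delta(X\triangleright x)=X\triangleright\delta(x)$ and $\partial(X\triangleright v)=[X,\partial(v)]$; 2.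 $\delta\{u,v\}=[u,v]-\partial(u)\triangleright v$; 3. $[x,y]=\{\delta(x),\delta(y)\}$; 4. $\{[u,v],w\}=\partial(u)\triangleright\{v,w\}+\{u,[v,w]\}-\partial(v)\triangleright\{u,w\}-\{v,[u,w]\}$; 5. $\{u,[v,w]\}=\{\delta\{u,v\},w\}-\{\delta\{u,w\},v\}$; 6. $\{\delta(x),v\}+\{v,\delta(x)\}=-\partial(v)\triangleright x$. A morphism is a triple of Lie algebra homomorphisms compatible with $\delta$, $\partial$, both actions and the Peiffer liftings. **Mixed second differential.** Let $A,B,C$ be Lie groups with Lie algebras $\mathfrak a,\mathfrak b,\mathfrak c$, and let $f\colon A\times B\to C$ be smooth with $f(a,1)=1$ for all $a\in A$. For each $a$ the differential of $f(a,\cdot)$ at $1$ is a linear map $\mathfrak b\to\mathfrak c$. The mixed second differential of $f$ sends $(X,Y)\in\mathfrak a\times\mathfrak b$ to the derivative at $a=1$, in the direction $X$, of the $\mathfrak c$-valued function $a\mapsto d\bigl(f(a,\cdot)\bigr)_1(Y)$. **Theorem.** Let $\mathcal H=(L\xrightarrow{\delta}E\xrightarrow{\partial}G,\triangleright,\{,\})$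 be a 2-crossed module of Lie groups, and let $\mathfrak l,\mathfrak e,\mathfrak g$ be the Lie algebras of $L,E,G$. The differentials at the identity $\mathfrak l\xrightarrow{\delta}\mathfrak e\xrightarrow{\partial}\mathfrak g$, together with the induced actions of $\mathfrak g$ on $\mathfrak e$ and $\mathfrak l$ (the mixed second differentials of the action maps $G\times E\to E$ and $G\times L\to L$) and with the mixed second differential $\mathfrak e\times\mathfrak e\to\mathfrak l$ of the Peiffer lifting, form a differential 2-crossed module $\mathfrak H$. Moreover the assignment $\mathcal H\mapsto\mathfrak H$ is functorial: for every morphism $\mathcal H\to\mathcal H'$ the differentials at the identity of its three components form a morphism $\mathfrak H\to\mathfrak H'$, and this defines a functor from 2-crossed modules of Lie groups to differential 2-crossed modules. -/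

import Mathlib

open scoped Manifold ContDiff
open CategoryTheory

universe v u w

/-! ### Lie groups and differentials at the identity -/

/-- A finite-dimensional real smooth Lie group, modelled on the finite-dimensional normed space
`Model`. -/
structure LieGrp where
  Model : Type v
  [normedAddCommGroup : NormedAddCommGroup Model]
  [normedSpace : NormedSpace ℝ Model]
  [finiteDimensional : FiniteDimensional ℝ Model]
  carrier : Type u
  [topologicalSpace : TopologicalSpace carrier]
  [chartedSpace : ChartedSpace Model carrier]
  [group : Group carrier]
  [lieGroup : LieGroup 𝓘(ℝ, Model) ∞ carrier]

namespace LieGrp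

instance : CoeSort LieGrp.{v, u} (Type u) := ⟨LieGrp.carrier⟩

attribute [instance] normedAddCommGroup normedSpace finiteDimensional topologicalSpace
  chartedSpace group lieGroup

instance (G : LieGrp.{v, u}) : CompleteSpace G.Model := FiniteDimensional.complete ℝ G.Model

instance : ENat.LEInfty (minSmoothness ℝ 3) :=
  ⟨by rw [minSmoothness_of_isRCLikeNormedField]; exact ENat.LEInfty.out⟩

/-- The Lie algebra of `G`: the tangent space `T₁G`, with the bracket of left-invariant vector
fields. -/
abbrev lieAlg (G : LieGrp.{v, u}) : Type v := GroupLieAlgebra 𝓘(ℝ, G.Model) G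

/-- Smooth group homomorphisms. -/
abbrev Hom (G K : LieGrp.{v, u}) : Type u :=
  ContMDiffMonoidMorphism 𝓘(ℝ, G.Model) 𝓘(ℝ, K.Model) ∞ G K

/-- The identity homomorphism. -/
def Hom.id (G : LieGrp.{v, u}) : Hom G G where
  toMonoidHom := MonoidHom.id G
  contMDiff_toFun := contMDiff_id

/-- The composite `f₂ ∘ f₁`. -/
def Hom.comp {G K M : LieGrp.{v, u}} (f₂ : Hom K M) (f₁ : Hom G K) : Hom G M where
  toMonoidHom := f₂.toMonoidHom.comp f₁.toMonoidHom
  contMDiff_toFun := f₂.contMDiff_toFun.comp f₁.contMDiff_toFun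

/-- The differential at the identity `T₁G → T₁K` of a map `f : G → K` with `f 1 = 1`.
(The tangent space of `K` at any point is a copy of the model space of `K`, so the tangent space
at `f 1` is the one at `1`.) -/
noncomputable def differential {G K : LieGrp.{v, u}} (f : G → K) (X : G.lieAlg) : K.lieAlg :=
  (mfderiv 𝓘(ℝ, G.Model) 𝓘(ℝ, K.Model) f (1 : G) X : K.Model)

/-- The mixed second differential at `(1, 1)` of a map `f : A × B → C` such that `f a 1 = 1` for
all `a`, that is `(X, Y) ↦ ∂²/∂s∂t f (a s) (b t)` at `s = t = 0`, where `a` and `b` are curves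
through `1` with velocities `X` and `Y`. For each `a`, the differential at `1` of `f a` maps `T₁B`
to the fixed vector space `T₁C`; its value at `Y` is differentiated as a function of `a`, at `1`,
in the direction `X`. -/
noncomputable def mixedDifferential {A B C : LieGrp.{v, u}} (f : A → B → C)
    (X : A.lieAlg) (Y : B.lieAlg) : C.lieAlg :=
  (mfderiv 𝓘(ℝ, A.Model) 𝓘(ℝ, C.Model) (M' := C.Model)
    (fun a : A => differential (f a) Y) (1 : A) X : C.Model)

end LieGrp

/-! ### 2-crossed modules of Lie groups -/

/-- A 2-crossed module of Lie groups `L --δ--> E --bd--> G`, with smooth left actions `actE`,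
`actL` of `G` on `E` and `L` by automorphisms and Peiffer lifting `lift`. -/
structure LieTwoCrossedModule where
  L : LieGrp.{v, u}
  E : LieGrp.{v, u}
  G : LieGrp.{v, u}
  δ : LieGrp.Hom L E
  bd : LieGrp.Hom E G
  actE : G →* MulAut E
  actL : G →* MulAut L
  lift : E → E → L
  contMDiff_actE : ContMDiff (𝓘(ℝ, G.Model).prod 𝓘(ℝ, E.Model)) 𝓘(ℝ, E.Model) ∞
    (fun p : G × E => actE p.1 p.2)
  contMDiff_actL : ContMDiff (𝓘(ℝ, G.Model).prod 𝓘(ℝ, L.Model)) 𝓘(ℝ, L.Model) ∞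
    (fun p : G × L => actL p.1 p.2)
  contMDiff_lift : ContMDiff (𝓘(ℝ, E.Model).prod 𝓘(ℝ, E.Model)) 𝓘(ℝ, L.Model) ∞
    (fun p : E × E => lift p.1 p.2)
  bd_δ : ∀ l : L, bd (δ l) = 1
  δ_act : ∀ (g : G) (l : L), δ (actL g l) = actE g (δ l)
  bd_act : ∀ (g : G) (e : E), bd (actE g e) = g * bd e * g⁻¹
  act_lift : ∀ (g : G) (e f : E), actL g (lift e f) = lift (actE g e) (actE g f)
  /-- `δ {e, f} = ⟨e, f⟩` -/
  δ_lift : ∀ e f : E, δ (lift e f) = e * f * e⁻¹ * actE (bd e) f⁻¹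
  /-- `[l, k] = {δ l, δ k}` -/
  lift_δ_δ : ∀ l k : L, l * k * l⁻¹ * k⁻¹ = lift (δ l) (δ k)
  lift_mul_left : ∀ e f g : E,
    lift (e * f) g = lift e (f * g * f⁻¹) * actL (bd e) (lift f g)
  /-- `{e, f g} = {e, f} {e, g} {⟨e, g⟩⁻¹, bd e ▹ f}` -/
  lift_mul_right : ∀ e f g : E,
    lift e (f * g) =
      lift e f * lift e g * lift (e * g * e⁻¹ * actE (bd e) g⁻¹)⁻¹ (actE (bd e) f)
  lift_δ_mul_lift_δ : ∀ (e : E) (l : L),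
    lift (δ l) e * lift e (δ l) = l * actL (bd e) l⁻¹

namespace LieTwoCrossedModule

/-- A morphism of 2-crossed modules of Lie groups: three smooth homomorphisms compatible with the
boundary maps, the actions and the Peiffer liftings. -/
@[ext]
structure Hom (H K : LieTwoCrossedModule.{v, u}) where
  mapL : LieGrp.Hom H.L K.L
  mapE : LieGrp.Hom H.E K.E
  mapG : LieGrp.Hom H.G K.G
  map_δ : ∀ l, mapE (H.δ l) = K.δ (mapL l)
  map_bd : ∀ e, mapG (H.bd e) = K.bd (mapE e)
  map_actE : ∀ g e, mapE (H.actE g e) = K.actE (mapG g) (mapE e)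
  map_actL : ∀ g l, mapL (H.actL g l) = K.actL (mapG g) (mapL l)
  map_lift : ∀ e f, mapL (H.lift e f) = K.lift (mapE e) (mapE f)

instance : Category LieTwoCrossedModule.{v, u} where
  Hom := Hom
  id H :=
    { mapL := LieGrp.Hom.id H.L
      mapE := LieGrp.Hom.id H.E
      mapG := LieGrp.Hom.id H.G
      map_δ := fun _ => rfl
      map_bd := fun _ => rfl
      map_actE := fun _ _ => rfl
      map_actL := fun _ _ => rfl
      map_lift := fun _ _ => rfl }
  comp {H K M} φ ψ :=
    { mapL := ψ.mapL.comp φ.mapL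
      mapE := ψ.mapE.comp φ.mapE
      mapG := ψ.mapG.comp φ.mapG
      map_δ := fun l => (congrArg ψ.mapE (φ.map_δ l)).trans (ψ.map_δ _)
      map_bd := fun e => (congrArg ψ.mapG (φ.map_bd e)).trans (ψ.map_bd _)
      map_actE := fun g e => (congrArg ψ.mapE (φ.map_actE g e)).trans (ψ.map_actE _ _)
      map_actL := fun g l => (congrArg ψ.mapL (φ.map_actL g l)).trans (ψ.map_actL _ _)
      map_lift := fun e f => (congrArg ψ.mapL (φ.map_lift e f)).trans (ψ.map_lift _ _) }

end LieTwoCrossedModule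

/-! ### Differential 2-crossed modules -/

/-- The structure of a differential 2-crossed module `l --δ--> e --bd--> g` on three given real Lie
algebras, with left actions `actE`, `actL` of `g` on `e` and `l` by derivations (and on `g` by the
adjoint representation) and bilinear Peiffer lifting `lift`. -/
structure DifferentialTwoCrossedStructure (l e g : Type w) [LieRing l] [LieAlgebra ℝ l]
    [LieRing e] [LieAlgebra ℝ e] [LieRing g] [LieAlgebra ℝ g] where
  δ : l →ₗ⁅ℝ⁆ e
  bd : e →ₗ⁅ℝ⁆ g
  actE : g →ₗ⁅ℝ⁆ LieDerivation ℝ e e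
  actL : g →ₗ⁅ℝ⁆ LieDerivation ℝ l l
  lift : e →ₗ[ℝ] e →ₗ[ℝ] l
  bd_δ : ∀ x : l, bd (δ x) = 0
  δ_act : ∀ (X : g) (x : l), δ (actL X x) = actE X (δ x)
  bd_act : ∀ (X : g) (v : e), bd (actE X v) = ⁅X, bd v⁆
  act_lift : ∀ (X : g) (u v : e), actL X (lift u v) = lift (actE X u) v + lift u (actE X v)
  /-- `δ {u, v} = ⟨u, v⟩` -/
  δ_lift : ∀ u v : e, δ (lift u v) = ⁅u, v⁆ - actE (bd u) v
  lift_δ_δ : ∀ x y : l, ⁅x, y⁆ = lift (δ x) (δ y)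
  lift_lie_left : ∀ u v w : e,
    lift ⁅u, v⁆ w =
      actL (bd u) (lift v w) + lift u ⁅v, w⁆ - actL (bd v) (lift u w) - lift v ⁅u, w⁆
  lift_lie_right : ∀ u v w : e,
    lift u ⁅v, w⁆ = lift (δ (lift u v)) w - lift (δ (lift u w)) v
  lift_δ_add_lift_δ : ∀ (x : l) (v : e), lift (δ x) v + lift v (δ x) = -actL (bd v) x

/-- A differential 2-crossed module: a complex of three real Lie algebras with the above
structure. -/
structure DifferentialTwoCrossedModule where
  l : Type w
  e : Type w
  g : Type w
  [lieRingL : LieRing l]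
  [lieAlgebraL : LieAlgebra ℝ l]
  [lieRingE : LieRing e]
  [lieAlgebraE : LieAlgebra ℝ e]
  [lieRingG : LieRing g]
  [lieAlgebraG : LieAlgebra ℝ g]
  str : DifferentialTwoCrossedStructure l e g

namespace DifferentialTwoCrossedModule

attribute [instance] lieRingL lieAlgebraL lieRingE lieAlgebraE lieRingG lieAlgebraG

/-- The differential 2-crossed module given by a structure on three Lie algebras. -/
abbrev of {l e g : Type w} [LieRing l] [LieAlgebra ℝ l] [LieRing e] [LieAlgebra ℝ e]
    [LieRing g] [LieAlgebra ℝ g] (D : DifferentialTwoCrossedStructure l e g) :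
    DifferentialTwoCrossedModule.{w} where
  l := l
  e := e
  g := g
  str := D

/-- A morphism of differential 2-crossed modules: three Lie algebra homomorphisms compatible with
the boundary maps, the actions and the Peiffer liftings. -/
@[ext]
structure Hom (A B : DifferentialTwoCrossedModule.{w}) where
  mapL : A.l →ₗ⁅ℝ⁆ B.l
  mapE : A.e →ₗ⁅ℝ⁆ B.e
  mapG : A.g →ₗ⁅ℝ⁆ B.g
  map_δ : ∀ x, mapE (A.str.δ x) = B.str.δ (mapL x)
  map_bd : ∀ v, mapG (A.str.bd v) = B.str.bd (mapE v)
  map_actE : ∀ X v, mapE (A.str.actE X v) = B.str.actE (mapG X) (mapE v)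
  map_actL : ∀ X x, mapL (A.str.actL X x) = B.str.actL (mapG X) (mapL x)
  map_lift : ∀ u v, mapL (A.str.lift u v) = B.str.lift (mapE u) (mapE v)

instance : Category DifferentialTwoCrossedModule.{w} where
  Hom := Hom
  id A :=
    { mapL := LieHom.id
      mapE := LieHom.id
      mapG := LieHom.id
      map_δ := fun _ => rfl
      map_bd := fun _ => rfl
      map_actE := fun _ _ => rfl
      map_actL := fun _ _ => rfl
      map_lift := fun _ _ => rfl }
  comp {A B C} φ ψ :=
    { mapL := ψ.mapL.comp φ.mapL
      mapE := ψ.mapE.comp φ.mapE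
      mapG := ψ.mapG.comp φ.mapG
      map_δ := fun x => (congrArg ψ.mapE (φ.map_δ x)).trans (ψ.map_δ _)
      map_bd := fun v => (congrArg ψ.mapG (φ.map_bd v)).trans (ψ.map_bd _)
      map_actE := fun X v => (congrArg ψ.mapE (φ.map_actE X v)).trans (ψ.map_actE _ _)
      map_actL := fun X x => (congrArg ψ.mapL (φ.map_actL X x)).trans (ψ.map_actL _ _)
      map_lift := fun u v => (congrArg ψ.mapL (φ.map_lift u v)).trans (ψ.map_lift _ _) }

end DifferentialTwoCrossedModule

/-- `D` is the structure on the Lie algebras of `H` induced by `H`: its boundary maps are the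
differentials of those of `H`, and its actions and Peiffer lifting are the mixed second
differentials of those of `H`. -/
structure LieTwoCrossedModule.IsInduced (H : LieTwoCrossedModule.{v, u})
    (D : DifferentialTwoCrossedStructure H.L.lieAlg H.E.lieAlg H.G.lieAlg) : Prop where
  δ_eq : ∀ x, D.δ x = LieGrp.differential H.δ x
  bd_eq : ∀ v, D.bd v = LieGrp.differential H.bd v
  actE_eq : ∀ X v, D.actE X v = LieGrp.mixedDifferential (fun g e => H.actE g e) X v
  actL_eq : ∀ X x, D.actL X x = LieGrp.mixedDifferential (fun g l => H.actL g l) X x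
  lift_eq : ∀ u v, D.lift u v = LieGrp.mixedDifferential H.lift u v

/-!
The identities of a differential 2-crossed module are obtained by differentiating those of a
2-crossed module of Lie groups one variable at a time, so that charts are needed only for three
general facts.

If `f : A × B → C` is smooth and `f a 1 = 1`, the differential of `f a` at `1` is a linear map
between the fixed vector spaces `T₁B` and `T₁C`, so `a ↦ d(f a)₁` is a smooth map from `A` to a
vector space, and the mixed second differential of `f` is the differential of this map at `1`
(`Smooth₂.hasDerivOne_derivOne`). An identity between group elements thus becomes an identity of
functions with values in a vector space after one differentiation, and the remaining
differentiations are ordinary calculus. The three facts are: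

* `Smooth₂.mixed_swap`: if also `f 1 b = 1`, the order of the two differentiations is immaterial;
* `derivOne_bracket`: for a function `f` from `G` to a vector space, smooth near `1`, the value of
  `df₁` at `[u, v]` is the antisymmetrization in `u`, `v` of the mixed second derivative of
  `(g, h) ↦ f (g h)`, because left-invariant vector fields act on functions as derivations;
* `mixed_conj`: the mixed second differential of `(g, h) ↦ g h g⁻¹` is the Lie bracket. This
  follows from the first two facts, applied to a chart, by writing `g h = (g h g⁻¹) g`.

Write `Λ e` for the differential of `{e, ·}` at `1`, `R f` for that of `{·, f}`, and `λ` for the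
mixed second differential of the lifting; `λ` is the differential of `Λ`, and with its arguments
exchanged that of `R`. The equivariance of `δ` and `∂`, the preservation of brackets by
differentials and the compatibility of morphisms with actions and liftings are instances of the
naturality of mixed second differentials (`mixed_natural`); the compatibility of the action of `𝔤`
with the lifting and with the brackets is the Leibniz rule `HasDerivOne.leibniz`. Differentiating
`{e f, h} = {e, f h f⁻¹} (∂e ▹ {f, h})` in `h` gives `Λ (e f) = Λ e ∘ Ad f + (∂e ▹ ·) ∘ Λ f`, and
`derivOne_bracket` for the function `Λ` gives the formula for `{[u, v], w}`. Differentiating the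
expansion of `{e, f h}` in `e` instead gives `R (f h) = R f + R h - R f ∘ δ ∘ R h`, since
`⟨e, h⟩ = δ {e, h}`, and `derivOne_bracket` for `R` gives the formula for `{u, [v, w]}`.
-/

/-! ### Calculus at the identity of a Lie group -/

namespace LieGrp

open Filter Topology

section Calculus

variable {A B C G K : LieGrp.{v, u}} {E F : Type*} [NormedAddCommGroup E] [NormedSpace ℝ E]
  [NormedAddCommGroup F] [NormedSpace ℝ F] {M : Type*} [TopologicalSpace M] [ChartedSpace E M]

/-- The differential at `1` of a map `f` from a Lie group to a manifold modelled on `E`, as a map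
between the model spaces, of which the tangent spaces are copies; it is `0` if `f` is not
differentiable at `1`. -/
noncomputable def derivOne (E : Type*) [NormedAddCommGroup E] [NormedSpace ℝ E] {M : Type*}
    [TopologicalSpace M] [ChartedSpace E M] (f : G → M) : G.Model →L[ℝ] E :=
  mfderiv 𝓘(ℝ, G.Model) 𝓘(ℝ, E) f (1 : G)

/-- `f` is differentiable at `1`, with differential `f'` there. -/
def HasDerivOne (f : G → M) (f' : G.Model →L[ℝ] E) : Prop :=
  HasMFDerivAt 𝓘(ℝ, G.Model) 𝓘(ℝ, E) f (1 : G) f'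

lemma HasDerivOne.derivOne_eq {f : G → M} {f' : G.Model →L[ℝ] E} (h : HasDerivOne f f') :
    derivOne E f = f' :=
  HasMFDerivAt.mfderiv h

lemma HasDerivOne.unique {f : G → M} {f' f'' : G.Model →L[ℝ] E} (h : HasDerivOne f f')
    (h' : HasDerivOne f f'') : f' = f'' :=
  h.derivOne_eq.symm.trans h'.derivOne_eq

lemma _root_.MDifferentiableAt.hasDerivOne {f : G → M}
    (h : MDifferentiableAt 𝓘(ℝ, G.Model) 𝓘(ℝ, E) f (1 : G)) : HasDerivOne f (derivOne E f) :=
  h.hasMFDerivAt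

lemma _root_.ContMDiffAt.hasDerivOne {f : G → M}
    (h : ContMDiffAt 𝓘(ℝ, G.Model) 𝓘(ℝ, E) ∞ f (1 : G)) : HasDerivOne f (derivOne E f) :=
  (h.mdifferentiableAt (by simp)).hasDerivOne

lemma _root_.ContMDiff.hasDerivOne {f : G → M}
    (h : ContMDiff 𝓘(ℝ, G.Model) 𝓘(ℝ, E) ∞ f) : HasDerivOne f (derivOne E f) :=
  h.contMDiffAt.hasDerivOne

lemma HasDerivOne.comp {g : K → M} {f : G → K} {g' : K.Model →L[ℝ] E}
    {f' : G.Model →L[ℝ] K.Model} (hg : HasDerivOne g g') (hf : HasDerivOne f f') (h1 : f 1 = 1) :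
    HasDerivOne (fun x => g (f x)) (g' ∘L f') := by
  have key : ∀ y : K, y = 1 → HasMFDerivAt 𝓘(ℝ, K.Model) 𝓘(ℝ, E) g y g' := by
    rintro y rfl; exact hg
  exact HasMFDerivAt.comp (1 : G) (key _ h1) hf

lemma hasDerivOne_const (c : M) : HasDerivOne (fun _ : G => c) (0 : G.Model →L[ℝ] E) :=
  hasMFDerivAt_const c (1 : G)

lemma hasDerivOne_id : HasDerivOne (fun x : G => x) (ContinuousLinearMap.id ℝ G.Model) :=
  hasMFDerivAt_id (1 : G)

lemma _root_.HasFDerivAt.comp_hasDerivOne {f : G → E} {f' : G.Model →L[ℝ] E} {g : E → F}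
    {g' : E →L[ℝ] F} (hg : HasFDerivAt g g' (f 1)) (hf : HasDerivOne f f') :
    HasDerivOne (fun x => g (f x)) (g' ∘L f') :=
  HasMFDerivAt.comp (1 : G) hg.hasMFDerivAt hf

lemma HasDerivOne.clm_comp {f : G → E} {f' : G.Model →L[ℝ] E} (g : E →L[ℝ] F)
    (hf : HasDerivOne f f') : HasDerivOne (fun x => g (f x)) (g ∘L f') :=
  g.hasFDerivAt.comp_hasDerivOne hf

lemma HasDerivOne.prodMk {f : G → E} {f' : G.Model →L[ℝ] E} {g : G → F} {g' : G.Model →L[ℝ] F}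
    (hf : HasDerivOne f f') (hg : HasDerivOne g g') :
    HasDerivOne (fun x => (f x, g x)) (f'.prod g') :=
  ⟨hf.1.prodMk hg.1, hf.2.prodMk hg.2⟩

lemma HasDerivOne.add {f : G → E} {f' : G.Model →L[ℝ] E} {g : G → E} {g' : G.Model →L[ℝ] E}
    (hf : HasDerivOne f f') (hg : HasDerivOne g g') :
    HasDerivOne (fun x => f x + g x) (f' + g') :=
  HasMFDerivAt.add hf hg

lemma HasDerivOne.sub {f : G → E} {f' : G.Model →L[ℝ] E} {g : G → E} {g' : G.Model →L[ℝ] E}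
    (hf : HasDerivOne f f') (hg : HasDerivOne g g') :
    HasDerivOne (fun x => f x - g x) (f' - g') :=
  HasMFDerivAt.sub hf hg

/-- The Leibniz rule for the evaluation of linear maps. -/
lemma HasDerivOne.clm_apply {f : G → E →L[ℝ] F} {f' : G.Model →L[ℝ] E →L[ℝ] F} {g : G → E}
    {g' : G.Model →L[ℝ] E} (hf : HasDerivOne f f') (hg : HasDerivOne g g') :
    HasDerivOne (fun x => f x (g x)) (f'.flip (g 1) + f 1 ∘L g') := by
  have h := HasFDerivAt.comp_hasDerivOne (g := fun p : (E →L[ℝ] F) × E => p.1 p.2)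
    (isBoundedBilinearMap_apply.hasFDerivAt _) (hf.prodMk hg)
  convert h using 1
  ext X
  simp [add_comm]

/-- The chart at `1`, as a map to the model space. -/
noncomputable def chart (G : LieGrp.{v, u}) : G → G.Model := extChartAt 𝓘(ℝ, G.Model) (1 : G)

lemma contMDiffAt_chart : ContMDiffAt 𝓘(ℝ, G.Model) 𝓘(ℝ, G.Model) ∞ G.chart (1 : G) :=
  contMDiffAt_extChartAt

/-- The chart at `1` has differential the identity there, by the definition of the tangent space. -/
lemma hasDerivOne_chart : HasDerivOne G.chart (ContinuousLinearMap.id ℝ G.Model) := by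
  have h := (contMDiffAt_chart (G := G)).hasDerivOne
  rwa [show derivOne G.Model G.chart = ContinuousLinearMap.id ℝ G.Model from
    mfderiv_extChartAt_self] at h

/-- A map between Lie groups has the same differential at `1` as its expression in the chart. -/
lemma HasDerivOne.of_chart_comp {f : G → K} {f' : G.Model →L[ℝ] K.Model}
    (hf : HasDerivOne f f') (h1 : f 1 = 1) : HasDerivOne (fun x => K.chart (f x)) f' := by
  simpa using hasDerivOne_chart.comp hf h1

/-- Two-variable chain rule at `1`. -/
lemma HasDerivOne.comp₂ {f : A → B → M} {f₁ : A.Model →L[ℝ] E} {f₂ : B.Model →L[ℝ] E}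
    (hf : MDifferentiableAt (𝓘(ℝ, A.Model).prod 𝓘(ℝ, B.Model)) 𝓘(ℝ, E)
      (fun p : A × B => f p.1 p.2) (1, 1))
    (h₁ : HasDerivOne (fun a => f a 1) f₁) (h₂ : HasDerivOne (fun b => f 1 b) f₂)
    {p : G → A} {q : G → B} {p' : G.Model →L[ℝ] A.Model} {q' : G.Model →L[ℝ] B.Model}
    (hp : HasDerivOne p p') (hq : HasDerivOne q q') (hp1 : p 1 = 1) (hq1 : q 1 = 1) :
    HasDerivOne (fun x => f (p x) (q x)) (f₁ ∘L p' + f₂ ∘L q') := by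
  obtain ⟨T, hT⟩ : ∃ T : A.Model × B.Model →L[ℝ] E,
      HasMFDerivAt (𝓘(ℝ, A.Model).prod 𝓘(ℝ, B.Model)) 𝓘(ℝ, E)
        (fun p : A × B => f p.1 p.2) (1, 1) T := ⟨_, hf.hasMFDerivAt⟩
  have key : ∀ {H : LieGrp.{v, u}} {p : H → A} {q : H → B} {p' : H.Model →L[ℝ] A.Model}
      {q' : H.Model →L[ℝ] B.Model} (_ : HasDerivOne p p') (_ : HasDerivOne q q')
      (_ : p 1 = 1) (_ : q 1 = 1), HasDerivOne (fun x => f (p x) (q x)) (T ∘L p'.prod q') := by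
    intro H p q p' q' hp hq hp1 hq1
    have hT' : ∀ y : A × B, y = (1, 1) → HasMFDerivAt (𝓘(ℝ, A.Model).prod 𝓘(ℝ, B.Model)) 𝓘(ℝ, E)
        (fun p : A × B => f p.1 p.2) y T := by
      rintro y rfl; exact hT
    exact HasMFDerivAt.comp (1 : H) (hT' (p 1, q 1) (by rw [hp1, hq1])) (HasMFDerivAt.prodMk hp hq)
  have e₁ := h₁.unique (key hasDerivOne_id (hasDerivOne_const (1 : B)) rfl rfl)
  have e₂ := h₂.unique (key (hasDerivOne_const (1 : A)) hasDerivOne_id rfl rfl)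
  convert key hp hq hp1 hq1 using 1
  ext X
  simp [e₁, e₂, ← map_add]

/-- For vector-valued maps, differentiability at `1` is differentiability in the chart. -/
lemma hasDerivOne_iff {f : G → E} {f' : G.Model →L[ℝ] E} :
    HasDerivOne f f' ↔
      HasFDerivAt (fun x => f ((extChartAt 𝓘(ℝ, G.Model) (1 : G)).symm x)) f' (G.chart 1) := by
  have hw : writtenInExtChartAt 𝓘(ℝ, G.Model) 𝓘(ℝ, E) (1 : G) f =
      fun x => f ((extChartAt 𝓘(ℝ, G.Model) (1 : G)).symm x) := by
    ext x; rfl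
  constructor
  · intro h
    have h2 := h.2
    rw [hw, ModelWithCorners.range_eq_univ] at h2
    exact hasFDerivWithinAt_univ.1 h2
  · intro h
    refine ⟨?_, ?_⟩
    · have h1 : ContinuousAt (fun y => f ((extChartAt 𝓘(ℝ, G.Model) (1 : G)).symm (G.chart y)))
          (1 : G) := ContinuousAt.comp (f := G.chart)
            (g := fun x => f ((extChartAt 𝓘(ℝ, G.Model) (1 : G)).symm x)) h.continuousAt
            (continuousAt_extChartAt (I := 𝓘(ℝ, G.Model)) (1 : G))
      refine h1.congr ?_
      filter_upwards [extChartAt_source_mem_nhds (I := 𝓘(ℝ, G.Model)) (1 : G)] with y hy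
      rw [chart, (extChartAt 𝓘(ℝ, G.Model) (1 : G)).left_inv hy]
    · rw [hw]
      exact h.hasFDerivWithinAt

lemma HasDerivOne.congr_of_eventuallyEq {f g : G → M} {f' : G.Model →L[ℝ] E}
    (h : HasDerivOne f f') (hg : g =ᶠ[𝓝 1] f) : HasDerivOne g f' :=
  HasMFDerivAt.congr_of_eventuallyEq h hg

/-- The expression in the charts at `1` of a vector-valued function of two group variables. -/
noncomputable def inCharts {T : Type*} (f : A → B → T) (p : A.Model × B.Model) : T :=
  f ((extChartAt 𝓘(ℝ, A.Model) (1 : A)).symm p.1) ((extChartAt 𝓘(ℝ, B.Model) (1 : B)).symm p.2)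

lemma contDiffAt_inCharts {f : A → B → E}
    (hf : ContMDiffAt (𝓘(ℝ, A.Model).prod 𝓘(ℝ, B.Model)) 𝓘(ℝ, E) ∞
      (fun p : A × B => f p.1 p.2) (1, 1)) :
    ContDiffAt ℝ ∞ (inCharts f) (A.chart 1, B.chart 1) := by
  have hA := contMDiffOn_extChartAt_symm (I := 𝓘(ℝ, A.Model)) (n := ∞) (1 : A)
  have hB := contMDiffOn_extChartAt_symm (I := 𝓘(ℝ, B.Model)) (n := ∞) (1 : B)
  have hA' := hA.contMDiffAt (extChartAt_target_mem_nhds (I := 𝓘(ℝ, A.Model)) (1 : A))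
  have hB' := hB.contMDiffAt (extChartAt_target_mem_nhds (I := 𝓘(ℝ, B.Model)) (1 : B))
  rw [← contMDiffAt_iff_contDiffAt]
  have h1 : ContMDiffAt 𝓘(ℝ, A.Model × B.Model) 𝓘(ℝ, A.Model) ∞
    (fun p : A.Model × B.Model => p.1) (A.chart 1, B.chart 1) := contDiffAt_fst.contMDiffAt
  have h2 : ContMDiffAt 𝓘(ℝ, A.Model × B.Model) 𝓘(ℝ, B.Model) ∞
    (fun p : A.Model × B.Model => p.2) (A.chart 1, B.chart 1) := contDiffAt_snd.contMDiffAt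
  refine ContMDiffAt.comp_of_eq (g := fun p : A × B => f p.1 p.2) hf
    ((ContMDiffAt.comp (A.chart 1, B.chart 1) hA' h1).prodMk
      (ContMDiffAt.comp (A.chart 1, B.chart 1) hB' h2)) ?_
  simp [chart]

lemma eventually_chart_symm_left {T : Type*} (f : A → B → T) :
    ∀ᶠ a in 𝓝 (1 : A), ∀ y, f a ((extChartAt 𝓘(ℝ, B.Model) (1 : B)).symm y) =
      inCharts f (A.chart a, y) := by
  filter_upwards [extChartAt_source_mem_nhds (I := 𝓘(ℝ, A.Model)) (1 : A)] with a ha y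
  simp only [inCharts, chart]
  rw [(extChartAt 𝓘(ℝ, A.Model) (1 : A)).left_inv ha]

lemma eventually_chart_symm_right {T : Type*} (f : A → B → T) :
    ∀ᶠ b in 𝓝 (1 : B), ∀ x, f ((extChartAt 𝓘(ℝ, A.Model) (1 : A)).symm x) b =
      inCharts f (x, B.chart b) := by
  filter_upwards [extChartAt_source_mem_nhds (I := 𝓘(ℝ, B.Model)) (1 : B)] with b hb x
  simp only [inCharts, chart]
  rw [(extChartAt 𝓘(ℝ, B.Model) (1 : B)).left_inv hb]

lemma continuousAt_chart : ContinuousAt G.chart 1 :=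
  continuousAt_extChartAt (I := 𝓘(ℝ, G.Model)) (1 : G)

/-- Near `1`, the partial differentials of a function of two variables are those of its expression
in charts. -/
lemma eventually_hasDerivOne_left {f : A → B → E}
    (hf : ContMDiffAt (𝓘(ℝ, A.Model).prod 𝓘(ℝ, B.Model)) 𝓘(ℝ, E) ∞
      (fun p : A × B => f p.1 p.2) (1, 1)) :
    ∀ᶠ a in 𝓝 (1 : A), HasDerivOne (f a)
      (fderiv ℝ (inCharts f) (A.chart a, B.chart 1) ∘L .inr ℝ A.Model B.Model) := by
  have hd := (((contDiffAt_inCharts hf).of_le (m := 1) (by simp)).eventually (by simp)).mono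
    fun p hp => hp.differentiableAt (by simp)
  have hc : Tendsto (fun a : A => (A.chart a, B.chart 1)) (𝓝 1) (𝓝 (A.chart 1, B.chart 1)) :=
    continuousAt_chart.prodMk continuousAt_const
  filter_upwards [eventually_chart_symm_left f, hc.eventually hd] with a ha hd
  rw [hasDerivOne_iff, funext ha]
  exact hd.hasFDerivAt.comp (f := fun y => (A.chart a, y)) (B.chart 1)
    (hasFDerivAt_prodMk_right _ _)

lemma eventually_hasDerivOne_right {f : A → B → E}
    (hf : ContMDiffAt (𝓘(ℝ, A.Model).prod 𝓘(ℝ, B.Model)) 𝓘(ℝ, E) ∞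
      (fun p : A × B => f p.1 p.2) (1, 1)) :
    ∀ᶠ b in 𝓝 (1 : B), HasDerivOne (fun a => f a b)
      (fderiv ℝ (inCharts f) (A.chart 1, B.chart b) ∘L .inl ℝ A.Model B.Model) := by
  have hd := (((contDiffAt_inCharts hf).of_le (m := 1) (by simp)).eventually (by simp)).mono
    fun p hp => hp.differentiableAt (by simp)
  have hc : Tendsto (fun b : B => (A.chart 1, B.chart b)) (𝓝 1) (𝓝 (A.chart 1, B.chart 1)) :=
    continuousAt_const.prodMk continuousAt_chart
  filter_upwards [eventually_chart_symm_right f, hc.eventually hd] with b hb hd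
  rw [hasDerivOne_iff, funext hb]
  exact hd.hasFDerivAt.comp (f := fun x => (x, B.chart b)) (A.chart 1) (hasFDerivAt_prodMk_left _ _)

/-- The partial differential of a smooth vector-valued function of two variables is smooth. -/
lemma contMDiffAt_derivOne_left {f : A → B → E}
    (hf : ContMDiffAt (𝓘(ℝ, A.Model).prod 𝓘(ℝ, B.Model)) 𝓘(ℝ, E) ∞
      (fun p : A × B => f p.1 p.2) (1, 1)) :
    ContMDiffAt 𝓘(ℝ, A.Model) 𝓘(ℝ, B.Model →L[ℝ] E) ∞ (fun a => derivOne E (f a)) (1 : A) := by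
  have h1 : ContDiffAt ℝ ∞ (fun x : A.Model =>
      fderiv ℝ (inCharts f) (x, B.chart 1) ∘L .inr ℝ A.Model B.Model) (A.chart 1) := by
    have h2 : ContDiffAt ℝ ∞ (fderiv ℝ (inCharts f)) (A.chart 1, B.chart 1) :=
      (contDiffAt_inCharts hf).fderiv_right (by simp)
    exact (h2.comp (A.chart 1) (contDiffAt_id.prodMk contDiffAt_const)).clm_comp contDiffAt_const
  refine (h1.contMDiffAt.comp (1 : A) contMDiffAt_chart).congr_of_eventuallyEq ?_
  filter_upwards [eventually_hasDerivOne_left hf] with a ha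
  exact ha.derivOne_eq

/-- Symmetry of the mixed second differential of a vector-valued function of two variables. -/
lemma derivOne_derivOne_comm {f : A → B → E}
    (hf : ContMDiffAt (𝓘(ℝ, A.Model).prod 𝓘(ℝ, B.Model)) 𝓘(ℝ, E) ∞
      (fun p : A × B => f p.1 p.2) (1, 1)) (X : A.Model) (Y : B.Model) :
    derivOne (B.Model →L[ℝ] E) (fun a => derivOne E (f a)) X Y =
      derivOne (A.Model →L[ℝ] E) (fun b => derivOne E (fun a => f a b)) Y X := by
  have hs := contDiffAt_inCharts hf
  have h2 := (hs.fderiv_right (m := ∞) (by simp)).differentiableAt (by simp) |>.hasFDerivAt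
  have hl : HasDerivOne (fun a => derivOne E (f a)) _ :=
    (HasFDerivAt.comp_hasDerivOne (g := fun x =>
      fderiv ℝ (inCharts f) (x, B.chart 1) ∘L .inr ℝ A.Model B.Model)
      ((h2.comp (f := fun x => (x, B.chart 1)) (A.chart 1)
        (hasFDerivAt_prodMk_left _ _)).clm_comp (hasFDerivAt_const _ _))
      hasDerivOne_chart).congr_of_eventuallyEq
      ((eventually_hasDerivOne_left hf).mono fun a ha => ha.derivOne_eq)
  have hr : HasDerivOne (fun b => derivOne E (fun a => f a b)) _ :=
    (HasFDerivAt.comp_hasDerivOne (g := fun y =>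
      fderiv ℝ (inCharts f) (A.chart 1, y) ∘L .inl ℝ A.Model B.Model)
      ((h2.comp (f := fun y => (A.chart 1, y)) (B.chart 1)
        (hasFDerivAt_prodMk_right _ _)).clm_comp (hasFDerivAt_const _ _))
      hasDerivOne_chart).congr_of_eventuallyEq
      ((eventually_hasDerivOne_right hf).mono fun a ha => ha.derivOne_eq)
  rw [hl.derivOne_eq, hr.derivOne_eq]
  simpa using hs.isSymmSndFDerivAt (n := ∞) (by simpa using ENat.LEInfty.out) (X, 0) (0, Y)

end Calculus
end LieGrp

/-! ### Left-invariant vector fields and the Lie bracket -/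

namespace LieGrp

open Filter Topology VectorField

section Bracket

variable {A B C G K : LieGrp.{v, u}} {E : Type*} [NormedAddCommGroup E] [NormedSpace ℝ E]

/-- The Lie bracket of the Lie algebra of `G`, carried to the model space, of which the tangent
space at `1` is a copy. -/
noncomputable def bracket (u v : G.Model) : G.Model :=
  Bracket.bracket (L := G.lieAlg) (M := G.lieAlg) u v

/-- The left-invariant vector field with value `v` at `1`, with values in the model space. -/
noncomputable def leftField (v : G.Model) (g : G) : G.Model :=
  mulInvariantVectorField (I := 𝓘(ℝ, G.Model)) (v : G.lieAlg) g

lemma leftField_eq (v : G.Model) (g : G) :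
    leftField v g = derivOne G.Model (fun h : G => g * h) v := rfl

/-- The expression in the chart at `1` of the left-invariant vector field with value `v` at `1`. -/
noncomputable def chartField (v : G.Model) (x : G.Model) : G.Model :=
  mpullbackWithin 𝓘(ℝ, G.Model) 𝓘(ℝ, G.Model) (extChartAt 𝓘(ℝ, G.Model) (1 : G)).symm
    (mulInvariantVectorField (v : G.lieAlg)) (Set.range 𝓘(ℝ, G.Model)) x

lemma _root_.ContinuousLinearMap.inverse_apply_of_eq_id {T : E →L[ℝ] E}
    (h : T = ContinuousLinearMap.id ℝ E) (w : E) : T.inverse w = w := by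
  rw [h, ContinuousLinearMap.inverse_id, ContinuousLinearMap.id_apply]

lemma leftField_one (v : G.Model) :
    leftField v (1 : G) = v := by
  have h : derivOne G.Model (fun x : G => 1 * x) = ContinuousLinearMap.id ℝ G.Model := by
    simp only [one_mul]
    exact hasDerivOne_id.derivOne_eq
  exact DFunLike.congr_fun h v

lemma chartField_chart_one (v : G.Model) : chartField v (G.chart 1) = v := by
  refine (ContinuousLinearMap.inverse_apply_of_eq_id (E := G.Model)
    (mfderivWithin_range_extChartAt_symm (I := 𝓘(ℝ, G.Model)) (x := (1 : G))) _).trans ?_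
  have h : ∀ y : G, y = 1 → leftField v y = v := by
    rintro y rfl
    exact leftField_one v
  exact h _ (extChartAt_to_inv (I := 𝓘(ℝ, G.Model)) (1 : G))

lemma differentiableAt_chartField (v : G.Model) :
    DifferentiableAt ℝ (chartField v) (G.chart 1) := by
  have h := MDifferentiableWithinAt.differentiableWithinAt_mpullbackWithin_vectorField
    (mdifferentiableAt_mulInvariantVectorField (I := 𝓘(ℝ, G.Model)) (v : G.lieAlg)
      (g := (1 : G))).mdifferentiableWithinAt (s := Set.univ)
  have h' : DifferentiableWithinAt ℝ (chartField v) Set.univ (G.chart 1) := by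
    convert! h using 1
    simp
  exact differentiableWithinAt_univ.1 h'

lemma lie_eq_lieBracket_chartField (u v : G.Model) :
    bracket u v = lieBracket ℝ (chartField u) (chartField v) (G.chart 1) := by
  refine (ContinuousLinearMap.inverse_apply_of_eq_id (E := G.Model)
    (mfderiv_extChartAt_self (I := 𝓘(ℝ, G.Model)) (x := (1 : G))) _).trans ?_
  rw [← lieBracketWithin_univ]
  have hs : (extChartAt 𝓘(ℝ, G.Model) (1 : G)).symm ⁻¹' Set.univ ∩ Set.range 𝓘(ℝ, G.Model) =
      Set.univ := by simp
  rw [hs]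
  rfl

/-- Differentiation along a left-invariant vector field, in the chart. -/
lemma eventually_fderiv_chartField {f : G → E}
    (hf : ContMDiffAt 𝓘(ℝ, G.Model) 𝓘(ℝ, E) ∞ f (1 : G)) (v : G.Model) :
    ∀ᶠ x in 𝓝 (G.chart 1),
      fderiv ℝ (fun x => f ((extChartAt 𝓘(ℝ, G.Model) (1 : G)).symm x)) x (chartField v x) =
      derivOne E (fun h => f ((extChartAt 𝓘(ℝ, G.Model) (1 : G)).symm x * h)) v := by
  have hc : Tendsto (extChartAt 𝓘(ℝ, G.Model) (1 : G)).symm (𝓝 (G.chart 1)) (𝓝 1) := by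
    have h := continuousAt_extChartAt_symm (I := 𝓘(ℝ, G.Model)) (1 : G)
    rwa [ContinuousAt, extChartAt_to_inv] at h
  have hd : ∀ᶠ y in 𝓝 (1 : G), MDifferentiableAt 𝓘(ℝ, G.Model) 𝓘(ℝ, E) f y :=
    ((contMDiffAt_iff_contMDiffAt_nhds (n := 1) (by simp)).1 (hf.of_le (by simp))).mono
      fun p hp => hp.mdifferentiableAt (by simp)
  filter_upwards [extChartAt_target_mem_nhds (I := 𝓘(ℝ, G.Model)) (1 : G), hc.eventually hd]
    with x hx hfd
  set φ := extChartAt 𝓘(ℝ, G.Model) (1 : G) with hφ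
  have hinv := isInvertible_mfderivWithin_extChartAt_symm (I := 𝓘(ℝ, G.Model)) hx
  have hs : MDifferentiableAt 𝓘(ℝ, G.Model) 𝓘(ℝ, G.Model) φ.symm x := by
    have h := mdifferentiableWithinAt_extChartAt_symm (I := 𝓘(ℝ, G.Model)) hx
    rwa [ModelWithCorners.range_eq_univ, mdifferentiableWithinAt_univ] at h
  obtain ⟨f', hf'⟩ : ∃ f' : G.Model →L[ℝ] E,
    HasMFDerivAt 𝓘(ℝ, G.Model) 𝓘(ℝ, E) f (φ.symm x) f' := ⟨_, hfd.hasMFDerivAt⟩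
  obtain ⟨s', hs'⟩ : ∃ s' : G.Model →L[ℝ] G.Model,
    HasMFDerivAt 𝓘(ℝ, G.Model) 𝓘(ℝ, G.Model) φ.symm x s' := ⟨_, hs.hasMFDerivAt⟩
  have e1 : HasFDerivAt (fun x => f (φ.symm x)) (f' ∘L s') x :=
    (HasMFDerivAt.comp x hf' hs').hasFDerivAt
  have e2 : mfderivWithin 𝓘(ℝ, G.Model) 𝓘(ℝ, G.Model) φ.symm (Set.range 𝓘(ℝ, G.Model)) x = s' := by
    rw [ModelWithCorners.range_eq_univ, mfderivWithin_univ]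
    exact hs'.mfderiv
  have e3 : s' (chartField v x) = leftField v (φ.symm x) := by
    have h := hinv.self_apply_inverse
      (leftField v (φ.symm x))
    exact (DFunLike.congr_fun e2 (chartField v x)).symm.trans h
  have hm : HasDerivOne (fun h : G => φ.symm x * h) (derivOne G.Model fun h : G => φ.symm x * h) :=
    (contMDiff_mul_left (I := 𝓘(ℝ, G.Model)) (n := ∞)).hasDerivOne
  have e4 : HasDerivOne (fun h => f (φ.symm x * h))
      (f' ∘L derivOne G.Model fun h : G => φ.symm x * h) := by
    have key : ∀ y : G, y = φ.symm x → HasMFDerivAt 𝓘(ℝ, G.Model) 𝓘(ℝ, E) f y f' := by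
      rintro y rfl; exact hf'
    exact HasMFDerivAt.comp (1 : G) (key _ (mul_one _)) hm
  rw [e1.fderiv, e4.derivOne_eq, ContinuousLinearMap.comp_apply, ContinuousLinearMap.comp_apply, e3,
    leftField_eq]

lemma HasDerivOne.apply {E F : Type*} [NormedAddCommGroup E] [NormedSpace ℝ E]
    [NormedAddCommGroup F] [NormedSpace ℝ F] {f : G → E →L[ℝ] F} {f' : G.Model →L[ℝ] E →L[ℝ] F}
    (hf : HasDerivOne f f') (v : E) : HasDerivOne (fun x => f x v) (f'.flip v) := by
  simpa using hf.clm_apply (hasDerivOne_const v)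

lemma contMDiffAt_comp_mul {f : G → E} (hf : ContMDiffAt 𝓘(ℝ, G.Model) 𝓘(ℝ, E) ∞ f (1 : G)) :
    ContMDiffAt (𝓘(ℝ, G.Model).prod 𝓘(ℝ, G.Model)) 𝓘(ℝ, E) ∞
      (fun p : G × G => f (p.1 * p.2)) (1, 1) :=
  ContMDiffAt.comp_of_eq hf (contMDiff_mul 𝓘(ℝ, G.Model) ∞).contMDiffAt (mul_one 1)

/-- The Lie bracket is the commutator of the derivations of functions near `1` given by the
left-invariant vector fields. -/
theorem derivOne_bracket {f : G → E}
    (hf : ContMDiffAt 𝓘(ℝ, G.Model) 𝓘(ℝ, E) ∞ f (1 : G)) (u v : G.Model) :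
    derivOne E f (bracket u v) =
      derivOne (G.Model →L[ℝ] E) (fun g => derivOne E fun h => f (g * h)) u v -
      derivOne (G.Model →L[ℝ] E) (fun g => derivOne E fun h => f (g * h)) v u := by
  set F : G.Model → E := fun x => f ((extChartAt 𝓘(ℝ, G.Model) (1 : G)).symm x) with hF
  have hFd : ContDiffAt ℝ ∞ F (G.chart 1) := by
    rw [← contMDiffAt_iff_contDiffAt]
    refine ContMDiffAt.comp_of_eq hf ((contMDiffOn_extChartAt_symm (1 : G)).contMDiffAt
      (extChartAt_target_mem_nhds (I := 𝓘(ℝ, G.Model)) (1 : G))) ?_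
    exact extChartAt_to_inv (1 : G)
  have key : ∀ u v : G.Model,
      derivOne (G.Model →L[ℝ] E) (fun g => derivOne E fun h => f (g * h)) u v =
        fderiv ℝ (fun x => fderiv ℝ F x (chartField v x)) (G.chart 1)
          (chartField u (G.chart 1)) := by
    intro u v
    have h := (contMDiffAt_derivOne_left (f := fun g h : G => f (g * h))
      (contMDiffAt_comp_mul hf)).hasDerivOne.apply v
    rw [hasDerivOne_iff] at h
    rw [Filter.EventuallyEq.fderiv_eq (eventually_fderiv_chartField hf v), h.fderiv,
      chartField_chart_one]
    rfl
  have hone : derivOne E f = fderiv ℝ F (G.chart 1) :=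
    (hasDerivOne_iff.1 hf.hasDerivOne).fderiv.symm
  rw [key, key, hone, lie_eq_lieBracket_chartField]
  exact fderiv_apply_lieBracket hFd (by simpa using ENat.LEInfty.out)
    (differentiableAt_chartField v) (differentiableAt_chartField u)

end Bracket

/-! ### Mixed second differentials -/

section Mixed

variable {A B C G K : LieGrp.{v, u}}

/-- Smoothness of a map `A × B → C`. -/
abbrev Smooth₂ (f : A → B → C) : Prop :=
  ContMDiff (𝓘(ℝ, A.Model).prod 𝓘(ℝ, B.Model)) 𝓘(ℝ, C.Model) ∞ (fun p : A × B => f p.1 p.2)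

/-- The mixed second differential, as a continuous bilinear map of the model spaces. It is meaningful
if `f a 1 = 1` for all `a`, so that all the differentials of `f a` at `1` have values in the tangent
space of `C` at `1`. -/
noncomputable def mixed (f : A → B → C) : A.Model →L[ℝ] B.Model →L[ℝ] C.Model :=
  derivOne (B.Model →L[ℝ] C.Model) fun a => derivOne C.Model (f a)

lemma Smooth₂.left {f : A → B → C} (hf : Smooth₂ f) (a : A) :
    ContMDiff 𝓘(ℝ, B.Model) 𝓘(ℝ, C.Model) ∞ (f a) :=
  ContMDiff.comp (g := fun p : A × B => f p.1 p.2) hf (contMDiff_const.prodMk contMDiff_id)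

lemma Smooth₂.swap {f : A → B → C} (hf : Smooth₂ f) : Smooth₂ (fun b a => f a b) :=
  ContMDiff.comp (g := fun p : A × B => f p.1 p.2) hf (contMDiff_snd.prodMk contMDiff_fst)

lemma Smooth₂.hasDerivOne_left {f : A → B → C} (hf : Smooth₂ f) (a : A) :
    HasDerivOne (f a) (derivOne C.Model (f a)) :=
  (hf.left a).hasDerivOne

lemma Smooth₂.contMDiffAt_chart {f : A → B → C} (hf : Smooth₂ f) (h : f 1 1 = 1) :
    ContMDiffAt (𝓘(ℝ, A.Model).prod 𝓘(ℝ, B.Model)) 𝓘(ℝ, C.Model) ∞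
      (fun p : A × B => C.chart (f p.1 p.2)) (1, 1) :=
  ContMDiffAt.comp_of_eq LieGrp.contMDiffAt_chart hf.contMDiffAt h

/-- Composing with the chart of `C` at `1` turns a map to `C` into a vector-valued one with the same
partial differentials. -/
lemma Smooth₂.derivOne_chart {f : A → B → C} (hf : Smooth₂ f) (h : ∀ a, f a 1 = 1) (a : A) :
    derivOne C.Model (fun b => C.chart (f a b)) = derivOne C.Model (f a) :=
  ((hf.hasDerivOne_left a).of_chart_comp (h a)).derivOne_eq

lemma Smooth₂.contMDiffAt_derivOne {f : A → B → C} (hf : Smooth₂ f) (h : ∀ a, f a 1 = 1) :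
    ContMDiffAt 𝓘(ℝ, A.Model) 𝓘(ℝ, B.Model →L[ℝ] C.Model) ∞
      (fun a => derivOne C.Model (f a)) (1 : A) := by
  simpa only [hf.derivOne_chart h] using contMDiffAt_derivOne_left (f := fun a b => C.chart (f a b))
    (hf.contMDiffAt_chart (h 1))

lemma Smooth₂.hasDerivOne_derivOne {f : A → B → C} (hf : Smooth₂ f) (h : ∀ a, f a 1 = 1) :
    HasDerivOne (fun a => derivOne C.Model (f a)) (mixed f) :=
  (hf.contMDiffAt_derivOne h).hasDerivOne

/-- The mixed second differential does not depend on the order of differentiation. -/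
lemma Smooth₂.mixed_swap {f : A → B → C} (hf : Smooth₂ f) (h : ∀ a, f a 1 = 1)
    (h' : ∀ b, f 1 b = 1) (X : A.Model) (Y : B.Model) :
    mixed (fun b a => f a b) Y X = mixed f X Y := by
  have h1 := derivOne_derivOne_comm (f := fun a b => C.chart (f a b))
    (hf.contMDiffAt_chart (h 1)) X Y
  simp only [hf.derivOne_chart h, hf.swap.derivOne_chart h'] at h1
  exact h1.symm

lemma smooth₂_conj : Smooth₂ (fun g h : G => g * h * g⁻¹) :=
  (contMDiff_fst.mul contMDiff_snd).mul contMDiff_fst.inv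

/-- The differential of the adjoint representation is the adjoint representation of the Lie
algebra. -/
theorem mixed_conj (u v : G.Model) : mixed (fun g h : G => g * h * g⁻¹) u v = bracket u v := by
  have hc := contMDiffAt_chart (G := G)
  have hm := contMDiffAt_comp_mul hc
  have hm' : ContMDiffAt (𝓘(ℝ, G.Model).prod 𝓘(ℝ, G.Model)) 𝓘(ℝ, G.Model) ∞
      (fun p : G × G => G.chart (p.2 * p.1)) (1, 1) :=
    ContMDiffAt.comp_of_eq hc (contMDiff_snd.mul contMDiff_fst).contMDiffAt (mul_one 1)
  -- `[u, v]` is the second derivative of `(g, h) ↦ g h`, minus that of `(g, h) ↦ h g`, in a chart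
  have h1 := derivOne_bracket hc u v
  rw [hasDerivOne_chart.derivOne_eq, ContinuousLinearMap.id_apply,
    derivOne_derivOne_comm (f := fun g h : G => G.chart (g * h)) hm v u] at h1
  -- `g h = (g h g⁻¹) g`: compare the derivatives of both sides in `h`, then in `g`
  have hR := (contMDiffAt_derivOne_left (f := fun g h : G => G.chart (h * g)) hm').hasDerivOne
  have hA := (smooth₂_conj (G := G)).hasDerivOne_derivOne (by simp)
  have hL := (contMDiffAt_derivOne_left (f := fun g h : G => G.chart (g * h))
    hm).hasDerivOne.apply v
  have h2 := hL.unique ((hR.clm_apply (hA.apply v)).congr_of_eventuallyEq (by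
    filter_upwards [eventually_hasDerivOne_left (f := fun g h : G => G.chart (h * g)) hm'] with g hg
    have h3 := hg.comp (smooth₂_conj.hasDerivOne_left g) (by simp)
    simp only [inv_mul_cancel_right] at h3
    rw [h3.derivOne_eq, hg.derivOne_eq]
    rfl))
  have h4 := DFunLike.congr_fun h2 u
  simp only [one_mul, mul_one, inv_one, hasDerivOne_id.derivOne_eq, hasDerivOne_chart.derivOne_eq,
    ContinuousLinearMap.flip_apply, add_apply, ContinuousLinearMap.id_apply,
    ContinuousLinearMap.comp_apply] at h4
  rw [h1, h4, add_sub_cancel_left]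

lemma hasDerivOne_Ad (G : LieGrp.{v, u}) :
    HasDerivOne (fun g => derivOne G.Model fun h : G => g * h * g⁻¹)
      (mixed fun g h : G => g * h * g⁻¹) :=
  smooth₂_conj.hasDerivOne_derivOne (by simp)

end Mixed

end LieGrp

/-! ### Naturality and infinitesimal invariance -/

namespace LieGrp

section Calculus

variable {A B C A' B' C' G K : LieGrp.{v, u}} {E F V : Type*}
  [NormedAddCommGroup E] [NormedSpace ℝ E] [NormedAddCommGroup F] [NormedSpace ℝ F]
  [NormedAddCommGroup V] [NormedSpace ℝ V]

lemma HasDerivOne.mul {f g : G → K} {f' g' : G.Model →L[ℝ] K.Model} (hf : HasDerivOne f f')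
    (hg : HasDerivOne g g') (hf1 : f 1 = 1) (hg1 : g 1 = 1) :
    HasDerivOne (fun x => f x * g x) (f' + g') := by
  have h := HasDerivOne.comp₂ (f := fun x y : K => x * y)
    ((contMDiff_mul 𝓘(ℝ, K.Model) ∞).mdifferentiable (by simp) (1, 1))
    (by simpa using hasDerivOne_id) (by simpa using hasDerivOne_id) hf hg hf1 hg1
  simpa using h

/-- The differential of the inversion is `-1`, from `x⁻¹ * x = 1`. -/
lemma HasDerivOne.inv {f : G → K} {f' : G.Model →L[ℝ] K.Model} (hf : HasDerivOne f f')
    (hf1 : f 1 = 1) : HasDerivOne (fun x => (f x)⁻¹) (-f') := by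
  have hi : HasDerivOne (fun x : K => x⁻¹) (derivOne K.Model fun x : K => x⁻¹) :=
    (contMDiff_inv 𝓘(ℝ, K.Model) ∞).hasDerivOne
  have h := (hi.mul hasDerivOne_id inv_one rfl).unique
    (by simpa using hasDerivOne_const (G := K) (1 : K))
  rw [eq_neg_of_add_eq_zero_left h] at hi
  simpa using hi.comp hf hf1

/-- The mixed second differential is natural: it is compatible with maps that intertwine `f` and
`f'`. -/
lemma mixed_natural {f : A → B → C} {f' : A' → B' → C'} (hf : Smooth₂ f) (hf' : Smooth₂ f')
    (h1 : ∀ a, f a 1 = 1) (h1' : ∀ a, f' a 1 = 1) {α : A → A'} {β : B → B'} {γ : C → C'}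
    {dα : A.Model →L[ℝ] A'.Model} {dβ : B.Model →L[ℝ] B'.Model} {dγ : C.Model →L[ℝ] C'.Model}
    (hα : HasDerivOne α dα) (hβ : HasDerivOne β dβ) (hγ : HasDerivOne γ dγ)
    (hα1 : α 1 = 1) (hβ1 : β 1 = 1) (h : ∀ a b, γ (f a b) = f' (α a) (β b))
    (X : A.Model) (Y : B.Model) : dγ (mixed f X Y) = mixed f' (dα X) (dβ Y) := by
  have key : ∀ a, dγ (derivOne C.Model (f a) Y) = derivOne C'.Model (f' (α a)) (dβ Y) := by
    intro a
    have e1 := hγ.comp (hf.hasDerivOne_left a) (h1 a)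
    have e2 := (hf'.hasDerivOne_left (α a)).comp hβ hβ1
    simp only [h] at e1
    exact DFunLike.congr_fun (e1.unique e2) Y
  have e1 := ((hf.hasDerivOne_derivOne h1).apply Y).clm_comp dγ
  have e2 := ((hf'.hasDerivOne_derivOne h1').comp hα hα1).apply (dβ Y)
  simp only [key] at e1
  exact DFunLike.congr_fun (e1.unique e2) X

/-- If a bilinear map is invariant under families of linear maps parametrized by `G`, which are the
identity at `1`, it satisfies the Leibniz rule for their derivatives. -/
lemma HasDerivOne.leibniz {b : E →L[ℝ] F →L[ℝ] V} {p : G → E →L[ℝ] E} {q : G → F →L[ℝ] F}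
    {r : G → V →L[ℝ] V} {p' : G.Model →L[ℝ] E →L[ℝ] E} {q' : G.Model →L[ℝ] F →L[ℝ] F}
    {r' : G.Model →L[ℝ] V →L[ℝ] V} (hp : HasDerivOne p p') (hq : HasDerivOne q q')
    (hr : HasDerivOne r r') (hp1 : p 1 = .id ℝ E) (hq1 : q 1 = .id ℝ F)
    (h : ∀ g x y, r g (b x y) = b (p g x) (q g y)) (X : G.Model) (x : E) (y : F) :
    r' X (b x y) = b (p' X x) y + b x (q' X y) := by
  have e1 := hr.apply (b x y)
  have e2 := ((hp.apply x).clm_comp b).clm_apply (hq.apply y)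
  simp only [h] at e1
  simpa [hp1, hq1] using DFunLike.congr_fun (e1.unique e2) X

/-- `derivOne_bracket` with the derivatives along left-invariant vector fields given as functions
`Φ v`, with differentials `Φ' v` at `1`. -/
lemma derivOne_bracket_of {f : G → E} (hf : ContMDiffAt 𝓘(ℝ, G.Model) 𝓘(ℝ, E) ∞ f (1 : G))
    {Φ : G.Model → G → E} {Φ' : G.Model → G.Model →L[ℝ] E}
    (h : ∀ v g, derivOne E (fun h => f (g * h)) v = Φ v g) (hΦ : ∀ v, HasDerivOne (Φ v) (Φ' v))
    (u v : G.Model) : derivOne E f (bracket u v) = Φ' v u - Φ' u v := by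
  have key : ∀ u v, derivOne (G.Model →L[ℝ] E) (fun g => derivOne E fun h => f (g * h)) u v =
      Φ' v u := by
    intro u v
    have e := (contMDiffAt_derivOne_left (f := fun g h : G => f (g * h))
      (contMDiffAt_comp_mul hf)).hasDerivOne.apply v
    simp only [h] at e
    exact DFunLike.congr_fun (e.unique (hΦ v)) u
  rw [derivOne_bracket hf, key, key]

lemma Hom.hasDerivOne (φ : Hom G K) : HasDerivOne φ (derivOne K.Model φ) :=
  φ.contMDiff_toFun.hasDerivOne

/-- The differential of a homomorphism preserves brackets. -/
lemma bracket_map {φ : G →* K} {φ' : G.Model →L[ℝ] K.Model} (hφ : HasDerivOne φ φ')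
    (u v : G.Model) : φ' (bracket u v) = bracket (φ' u) (φ' v) := by
  rw [← mixed_conj, ← mixed_conj]
  exact mixed_natural smooth₂_conj smooth₂_conj (by simp) (by simp) hφ hφ hφ
    (map_one φ) (map_one φ) (by simp) u v

/-! ### Actions by automorphisms -/

section Action

variable {a : G →* MulAut K}

lemma derivOne_act_one : derivOne K.Model (fun k => a 1 k) = .id ℝ K.Model := by
  simpa using (hasDerivOne_id (G := K)).derivOne_eq

lemma derivOne_act_mul (ha : Smooth₂ fun g k => a g k) (g h : G) :
    derivOne K.Model (fun k => a (g * h) k) =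
    derivOne K.Model (fun k => a g k) ∘L derivOne K.Model (fun k => a h k) := by
  simpa using ((ha.hasDerivOne_left g).comp (ha.hasDerivOne_left h) (by simp)).derivOne_eq

/-- An action by automorphisms induces an action of the Lie algebra. -/
lemma mixed_act_bracket (ha : Smooth₂ fun g k => a g k) (X Y : G.Model)
    (k : K.Model) :
    mixed (fun g k => a g k) (bracket X Y) k =
      mixed (fun g k => a g k) X (mixed (fun g k => a g k) Y k) -
      mixed (fun g k => a g k) Y (mixed (fun g k => a g k) X k) := by
  have hd := ha.hasDerivOne_derivOne (by simp)
  have hs : ContMDiffAt 𝓘(ℝ, G.Model) 𝓘(ℝ, K.Model) ∞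
      (fun g => derivOne K.Model (fun k => a g k) k) (1 : G) :=
    (ha.contMDiffAt_derivOne (by simp)).clm_apply contMDiffAt_const
  have h := derivOne_bracket_of hs
    (Φ := fun Y g => derivOne K.Model (fun k => a g k) (mixed (fun g k => a g k) Y k))
    (fun v g => by
      simp only [derivOne_act_mul ha, ContinuousLinearMap.comp_apply]
      rw [((hd.apply k).clm_comp _).derivOne_eq]
      rfl)
    (fun v => hd.apply _) X Y
  rw [(hd.apply k).derivOne_eq] at h
  exact h

/-- The induced action of the Lie algebra is by derivations. -/
lemma mixed_act_derivation (ha : Smooth₂ fun g k => a g k) (X : G.Model)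
    (x y : K.Model) :
    mixed (fun g k => a g k) X (bracket x y) =
      bracket (mixed (fun g k => a g k) X x) y + bracket x (mixed (fun g k => a g k) X y) := by
  have hd := ha.hasDerivOne_derivOne (by simp)
  simp only [← mixed_conj]
  refine hd.leibniz hd hd derivOne_act_one derivOne_act_one (fun g x y => ?_) X x y
  rw [mixed_conj, mixed_conj]
  exact bracket_map (φ := (a g).toMonoidHom) (ha.hasDerivOne_left g) x y

end Action

end Calculus

end LieGrp

/-! ### The identities of the differential 2-crossed module -/

namespace LieTwoCrossedModule

open LieGrp

variable (H : LieTwoCrossedModule.{v, u})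

lemma lift_one_left (f : H.E) : H.lift 1 f = 1 := by
  simpa using H.lift_mul_left 1 1 f

lemma lift_one_right (e : H.E) : H.lift e 1 = 1 := by
  simpa [H.lift_one_left] using H.lift_mul_right e 1 1

lemma smooth_actE : Smooth₂ (fun g e => H.actE g e) := H.contMDiff_actE

lemma smooth_actL : Smooth₂ (fun g l => H.actL g l) := H.contMDiff_actL

lemma smooth_lift : Smooth₂ H.lift := H.contMDiff_lift

/-- The differential of `δ`. -/
noncomputable abbrev dδ : H.L.Model →L[ℝ] H.E.Model := derivOne H.E.Model H.δ

/-- The differential of `∂`. -/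
noncomputable abbrev dbd : H.E.Model →L[ℝ] H.G.Model := derivOne H.G.Model H.bd

/-- The induced action of `𝔤` on `𝔢`. -/
noncomputable abbrev dactE : H.G.Model →L[ℝ] H.E.Model →L[ℝ] H.E.Model :=
  mixed fun g e => H.actE g e

/-- The induced action of `𝔤` on `𝔩`. -/
noncomputable abbrev dactL : H.G.Model →L[ℝ] H.L.Model →L[ℝ] H.L.Model :=
  mixed fun g l => H.actL g l

/-- The mixed second differential of the Peiffer lifting. -/
noncomputable abbrev dlift : H.E.Model →L[ℝ] H.E.Model →L[ℝ] H.L.Model := mixed H.lift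

lemma hasDerivOne_actE : HasDerivOne (fun g => derivOne H.E.Model fun e => H.actE g e) H.dactE :=
  H.smooth_actE.hasDerivOne_derivOne (by simp)

lemma hasDerivOne_actL : HasDerivOne (fun g => derivOne H.L.Model fun l => H.actL g l) H.dactL :=
  H.smooth_actL.hasDerivOne_derivOne (by simp)

lemma hasDerivOne_lift : HasDerivOne (fun e => derivOne H.L.Model (H.lift e)) H.dlift :=
  H.smooth_lift.hasDerivOne_derivOne H.lift_one_right

/-- The partial differentials in the first variable also have `dlift` as differential, because mixed
second differentials are symmetric. -/
lemma hasDerivOne_lift_swap :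
    HasDerivOne (fun f => derivOne H.L.Model fun e => H.lift e f) H.dlift.flip := by
  have h := H.smooth_lift.swap.hasDerivOne_derivOne H.lift_one_left
  convert h using 1
  ext Y X
  exact (H.smooth_lift.mixed_swap H.lift_one_right H.lift_one_left X Y).symm

lemma dbd_dδ (x : H.L.Model) : H.dbd (H.dδ x) = 0 := by
  have h := H.bd.hasDerivOne.comp H.δ.hasDerivOne (map_one _)
  simp only [H.bd_δ] at h
  exact DFunLike.congr_fun (h.unique (hasDerivOne_const _)) x

lemma dδ_dactL (X : H.G.Model) (x : H.L.Model) : H.dδ (H.dactL X x) = H.dactE X (H.dδ x) :=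
  mixed_natural H.smooth_actL H.smooth_actE (by simp) (by simp) hasDerivOne_id H.δ.hasDerivOne
    H.δ.hasDerivOne rfl (map_one _) H.δ_act X x

lemma dbd_dactE (X : H.G.Model) (v : H.E.Model) : H.dbd (H.dactE X v) = bracket X (H.dbd v) := by
  rw [← mixed_conj]
  exact mixed_natural H.smooth_actE smooth₂_conj (by simp) (by simp) hasDerivOne_id
    H.bd.hasDerivOne H.bd.hasDerivOne rfl (map_one _) H.bd_act X v

lemma dactL_dlift (X : H.G.Model) (u v : H.E.Model) :
    H.dactL X (H.dlift u v) = H.dlift (H.dactE X u) v + H.dlift u (H.dactE X v) := by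
  refine H.hasDerivOne_actE.leibniz H.hasDerivOne_actE H.hasDerivOne_actL
    derivOne_act_one derivOne_act_one (fun g x y => ?_) X u v
  exact mixed_natural H.smooth_lift H.smooth_lift H.lift_one_right H.lift_one_right
    (H.smooth_actE.hasDerivOne_left g) (H.smooth_actE.hasDerivOne_left g)
    (H.smooth_actL.hasDerivOne_left g) (by simp) (by simp) (H.act_lift g) x y

lemma dδ_dlift (u v : H.E.Model) :
    H.dδ (H.dlift u v) = bracket u v - H.dactE (H.dbd u) v := by
  have key : ∀ e, H.dδ (derivOne H.L.Model (H.lift e) v) =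
      derivOne H.E.Model (fun f => e * f * e⁻¹) v -
        derivOne H.E.Model (fun f => H.actE (H.bd e) f) v := by
    intro e
    have e1 := H.δ.hasDerivOne.comp (H.smooth_lift.hasDerivOne_left e) (H.lift_one_right e)
    have e2 := (smooth₂_conj.hasDerivOne_left e).mul
      ((H.smooth_actE.hasDerivOne_left (H.bd e)).comp (hasDerivOne_id.inv rfl) inv_one)
      (by simp) (by simp)
    simp only [H.δ_lift] at e1
    simpa [sub_eq_add_neg] using DFunLike.congr_fun (e1.unique e2) v
  have e1 := (H.hasDerivOne_lift.apply v).clm_comp H.dδ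
  have e2 := ((hasDerivOne_Ad H.E).apply v).sub
    ((H.hasDerivOne_actE.comp H.bd.hasDerivOne (map_one _)).apply v)
  simp only [key] at e1
  rw [← mixed_conj]
  exact DFunLike.congr_fun (e1.unique e2) u

lemma dlift_dδ_dδ (x y : H.L.Model) : bracket x y = H.dlift (H.dδ x) (H.dδ y) := by
  -- from `l k l⁻¹ = {δ l, δ k} k`, differentiated in `k`
  have key : ∀ l, derivOne H.L.Model (fun k => l * k * l⁻¹) y =
      derivOne H.L.Model (H.lift (H.δ l)) (H.dδ y) + y := by
    intro l
    have e1 := smooth₂_conj.hasDerivOne_left l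
    have e2 := ((H.smooth_lift.hasDerivOne_left (H.δ l)).comp H.δ.hasDerivOne (map_one _)).mul
      hasDerivOne_id (by simp [H.lift_one_right]) rfl
    simp only [← H.lift_δ_δ, inv_mul_cancel_right] at e2
    exact DFunLike.congr_fun (e1.unique e2) y
  have e1 := (hasDerivOne_Ad H.L).apply y
  have e2 := ((H.hasDerivOne_lift.comp H.δ.hasDerivOne (map_one _)).apply (H.dδ y)).add
    (hasDerivOne_const (G := H.L) y)
  simp only [key] at e1
  rw [← mixed_conj]
  simpa using! DFunLike.congr_fun (e1.unique e2) x

/-- Obtained by antisymmetrizing, in the directions of `e` and `f`, the second derivative of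
`Λ (e f) = Λ e ∘ Ad f + (∂e ▹ ·) ∘ Λ f`, where `Λ e` is the differential of `{e, ·}`. -/
lemma dlift_bracket_left (u v w : H.E.Model) :
    H.dlift (bracket u v) w =
      H.dactL (H.dbd u) (H.dlift v w) + H.dlift u (bracket v w) -
        H.dactL (H.dbd v) (H.dlift u w) - H.dlift v (bracket u w) := by
  have key : ∀ e f, derivOne H.L.Model (H.lift (e * f)) w =
      derivOne H.L.Model (H.lift e) (derivOne H.E.Model (fun h => f * h * f⁻¹) w) +
        derivOne H.L.Model (fun l => H.actL (H.bd e) l) (derivOne H.L.Model (H.lift f) w) := by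
    intro e f
    have e1 := H.smooth_lift.hasDerivOne_left (e * f)
    have e2 := ((H.smooth_lift.hasDerivOne_left e).comp (smooth₂_conj.hasDerivOne_left f)
      (by simp)).mul ((H.smooth_actL.hasDerivOne_left (H.bd e)).comp
        (H.smooth_lift.hasDerivOne_left f) (H.lift_one_right f))
      (by simp [H.lift_one_right]) (by simp [H.lift_one_right])
    rw [show H.lift (e * f) = _ from funext fun h => H.lift_mul_left e f h] at e1 ⊢
    exact DFunLike.congr_fun (e1.unique e2) w
  have hs : ContMDiffAt 𝓘(ℝ, H.E.Model) 𝓘(ℝ, H.L.Model) ∞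
      (fun e => derivOne H.L.Model (H.lift e) w) (1 : H.E) :=
    (H.smooth_lift.contMDiffAt_derivOne H.lift_one_right).clm_apply contMDiffAt_const
  have h := derivOne_bracket_of hs
    (Φ := fun v e => derivOne H.L.Model (H.lift e) (bracket v w) +
      derivOne H.L.Model (fun l => H.actL (H.bd e) l) (H.dlift v w))
    (fun v e => by
      simp only [key]
      rw [((((hasDerivOne_Ad H.E).apply w).clm_comp _).add
        ((H.hasDerivOne_lift.apply w).clm_comp _)).derivOne_eq, ← mixed_conj]
      rfl)
    (fun v => (H.hasDerivOne_lift.apply _).add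
      ((H.hasDerivOne_actL.comp H.bd.hasDerivOne (map_one _)).apply _)) u v
  rw [(H.hasDerivOne_lift.apply w).derivOne_eq] at h
  refine h.trans ?_
  simp only [add_apply, ContinuousLinearMap.flip_apply, ContinuousLinearMap.comp_apply]
  abel

/-- Obtained by antisymmetrizing, in the directions of `f` and `h`, the second derivative of
`R (f h) = R f + R h - R f ∘ δ ∘ R h`, where `R f` is the differential of `{·, f}`. -/
lemma dlift_bracket_right (u v w : H.E.Model) :
    H.dlift u (bracket v w) =
      H.dlift (H.dδ (H.dlift u v)) w - H.dlift (H.dδ (H.dlift u w)) v := by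
  set R : H.E → H.E.Model →L[ℝ] H.L.Model := fun f => derivOne H.L.Model fun e => H.lift e f
    with hR
  have hRd : HasDerivOne R H.dlift.flip := H.hasDerivOne_lift_swap
  have hRl : ∀ f, HasDerivOne (fun e => H.lift e f) (R f) :=
    fun f => H.smooth_lift.swap.hasDerivOne_left f
  have key : ∀ f h, R (f * h) u = R f u + R h u - R f (H.dδ (R h u)) := by
    intro f h
    -- The last factor `{⟨e, h⟩⁻¹, ∂e ▹ f}` is `k (⟨e, h⟩⁻¹) (∂e)` for `k x g = {x, g ▹ f}`, and
    -- `k 1 g = 1`, so only the first argument contributes to its differential at `e = 1`.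
    have hk : ContMDiff (𝓘(ℝ, H.E.Model).prod 𝓘(ℝ, H.G.Model)) 𝓘(ℝ, H.L.Model) ∞
        (fun p : H.E × H.G => H.lift p.1 (H.actE p.2 f)) :=
      H.contMDiff_lift.comp (contMDiff_fst.prodMk
        (H.contMDiff_actE.comp (contMDiff_snd.prodMk contMDiff_const)))
    have e3 := HasDerivOne.comp₂ (f := fun (x : H.E) (g : H.G) => H.lift x (H.actE g f))
      (hk.mdifferentiable (by simp) (1, 1)) (by simpa using hRl f)
      (by simpa [H.lift_one_left] using hasDerivOne_const (G := H.G) (1 : H.L))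
      ((H.δ.hasDerivOne.comp (hRl h) (H.lift_one_left h)).inv
        (by simp [H.lift_one_left])) H.bd.hasDerivOne (by simp [H.lift_one_left]) (map_one _)
    have e2 := ((hRl f).mul (hRl h) (H.lift_one_left f) (H.lift_one_left h)).mul e3
      (by simp [H.lift_one_left]) (by simp [H.lift_one_left])
    have e1 := hRl (f * h)
    simp only [H.lift_mul_right, ← H.δ_lift] at e1
    simpa [sub_eq_add_neg] using DFunLike.congr_fun (e1.unique e2) u
  have hs : ContMDiffAt 𝓘(ℝ, H.E.Model) 𝓘(ℝ, H.L.Model) ∞ (fun f => R f u) (1 : H.E) :=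
    (H.smooth_lift.swap.contMDiffAt_derivOne H.lift_one_left).clm_apply contMDiffAt_const
  have h := derivOne_bracket_of hs
    (Φ := fun w f => H.dlift u w - R f (H.dδ (H.dlift u w)))
    (fun w f => by
      simp only [key]
      rw [(((hasDerivOne_const (R f u)).add (hRd.apply u)).sub
        (((hRd.apply u).clm_comp H.dδ).clm_comp (R f))).derivOne_eq]
      simp)
    (fun w => (hasDerivOne_const _).sub (hRd.apply _)) v w
  rw [(hRd.apply u).derivOne_eq] at h
  refine h.trans ?_
  simp only [sub_apply, ContinuousLinearMap.flip_apply, zero_apply]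
  abel

lemma dlift_dδ_add (x : H.L.Model) (v : H.E.Model) :
    H.dlift (H.dδ x) v + H.dlift v (H.dδ x) = -H.dactL (H.dbd v) x := by
  have key : ∀ e, derivOne H.L.Model (fun f => H.lift f e) (H.dδ x) +
      derivOne H.L.Model (H.lift e) (H.dδ x) =
      x - derivOne H.L.Model (fun l => H.actL (H.bd e) l) x := by
    intro e
    have e1 := ((H.smooth_lift.swap.hasDerivOne_left e).comp H.δ.hasDerivOne (map_one _)).mul
      ((H.smooth_lift.hasDerivOne_left e).comp H.δ.hasDerivOne (map_one _))
      (by simp [H.lift_one_left]) (by simp [H.lift_one_right])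
    have e2 := hasDerivOne_id.mul ((H.smooth_actL.hasDerivOne_left (H.bd e)).comp
      (hasDerivOne_id.inv rfl) inv_one) rfl (by simp)
    simp only [H.lift_δ_mul_lift_δ] at e1
    simpa [sub_eq_add_neg] using DFunLike.congr_fun (e1.unique e2) x
  have e1 := (H.hasDerivOne_lift_swap.apply (H.dδ x)).add (H.hasDerivOne_lift.apply (H.dδ x))
  have e2 := (hasDerivOne_const (G := H.E) x).sub
    ((H.hasDerivOne_actL.comp H.bd.hasDerivOne (map_one _)).apply x)
  simp only [key] at e1
  simpa using! DFunLike.congr_fun (e1.unique e2) v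

end LieTwoCrossedModule

/-! ### The differential 2-crossed module and functoriality -/

namespace LieGrp

variable {G K M : LieGrp.{v, u}}

/-- The differential of a homomorphism of Lie groups, as a homomorphism of Lie algebras. -/
noncomputable def Hom.lieHom (φ : Hom G K) : G.lieAlg →ₗ⁅ℝ⁆ K.lieAlg where
  toFun := differential φ
  map_add' x y := (derivOne K.Model φ).map_add x y
  map_smul' c x := (derivOne K.Model φ).map_smul c x
  map_lie' {x y} := bracket_map (φ := φ.toMonoidHom) φ.hasDerivOne x y

lemma Hom.differential_id (x : G.lieAlg) : differential (Hom.id G) x = x :=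
  DFunLike.congr_fun (hasDerivOne_id (G := G)).derivOne_eq x

lemma Hom.differential_comp (φ : Hom G K) (ψ : Hom K M) (x : G.lieAlg) :
    differential (ψ.comp φ) x = differential ψ (differential φ x) :=
  DFunLike.congr_fun (ψ.hasDerivOne.comp φ.hasDerivOne (map_one φ)).derivOne_eq x

/-- The mixed second differential of a map which is trivial on `A × 1` is the value of the
continuous bilinear map `mixed f`. -/
lemma mixedDifferential_eq {A B C : LieGrp.{v, u}} {f : A → B → C} (hf : Smooth₂ f)
    (h : ∀ a, f a 1 = 1) (X : A.lieAlg) (Y : B.lieAlg) :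
    mixedDifferential f X Y = mixed f X Y :=
  DFunLike.congr_fun ((hf.hasDerivOne_derivOne h).apply (Y : B.Model)).derivOne_eq X

/-- The action of the Lie algebra of `G` on that of `K` by derivations, induced by a smooth action
of `G` on `K` by automorphisms. -/
noncomputable def lieAction {a : G →* MulAut K} (ha : Smooth₂ fun g k => a g k) :
    G.lieAlg →ₗ⁅ℝ⁆ LieDerivation ℝ K.lieAlg K.lieAlg where
  toFun X :=
    { toFun := fun x => mixed (fun g k => a g k) X x
      map_add' := fun x y => (mixed (fun g k => a g k) X).map_add x y
      map_smul' := fun c x => (mixed (fun g k => a g k) X).map_smul c x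
      leibniz' := fun x y => by
        refine (mixed_act_derivation ha X x y).trans ?_
        rw [← lie_skew y, sub_neg_eq_add, add_comm]
        rfl }
  map_add' X Y := LieDerivation.ext fun x =>
    DFunLike.congr_fun ((mixed (fun g k => a g k)).map_add X Y) x
  map_smul' c X := LieDerivation.ext fun x =>
    DFunLike.congr_fun ((mixed (fun g k => a g k)).map_smul c X) x
  map_lie' {X Y} := LieDerivation.ext fun x => by
    rw [LieDerivation.lie_apply]
    exact mixed_act_bracket ha X Y x

end LieGrp

namespace LieTwoCrossedModule

open LieGrp

/-- The differential 2-crossed module structure on the Lie algebras of a 2-crossed module of Lie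
groups. -/
noncomputable def toDifferential (H : LieTwoCrossedModule.{v, u}) :
    DifferentialTwoCrossedStructure H.L.lieAlg H.E.lieAlg H.G.lieAlg where
  δ := H.δ.lieHom
  bd := H.bd.lieHom
  actE := lieAction H.smooth_actE
  actL := lieAction H.smooth_actL
  lift := LinearMap.mk₂ ℝ (M := H.E.lieAlg) (Nₗ := H.E.lieAlg) (Pₗ := H.L.lieAlg)
    (fun u v => H.dlift u v)
    (fun u u' v => H.dlift.map_add₂ u u' v) (fun c u v => H.dlift.map_smul₂ c u v)
    (fun u v v' => (H.dlift u).map_add v v') (fun c u v => (H.dlift u).map_smul c v)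
  bd_δ := H.dbd_dδ
  δ_act := H.dδ_dactL
  bd_act := H.dbd_dactE
  act_lift := H.dactL_dlift
  δ_lift := H.dδ_dlift
  lift_δ_δ := H.dlift_dδ_dδ
  lift_lie_left := H.dlift_bracket_left
  lift_lie_right := H.dlift_bracket_right
  lift_δ_add_lift_δ := H.dlift_dδ_add

lemma isInduced_toDifferential (H : LieTwoCrossedModule.{v, u}) :
    H.IsInduced H.toDifferential where
  δ_eq _ := rfl
  bd_eq _ := rfl
  actE_eq X v := (mixedDifferential_eq H.smooth_actE (by simp) X v).symm
  actL_eq X x := (mixedDifferential_eq H.smooth_actL (by simp) X x).symm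
  lift_eq u v := (mixedDifferential_eq H.smooth_lift H.lift_one_right u v).symm

/-- The differential of a morphism of 2-crossed modules of Lie groups. -/
noncomputable def Hom.toDifferential {H K : LieTwoCrossedModule.{v, u}} (φ : Hom H K) :
    DifferentialTwoCrossedModule.Hom (DifferentialTwoCrossedModule.of H.toDifferential)
      (DifferentialTwoCrossedModule.of K.toDifferential) where
  mapL := φ.mapL.lieHom
  mapE := φ.mapE.lieHom
  mapG := φ.mapG.lieHom
  map_δ x := by
    refine (Hom.differential_comp H.δ φ.mapE x).symm.trans
      (Eq.trans ?_ (Hom.differential_comp φ.mapL K.δ x))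
    exact congrArg (fun f : H.L → K.E => differential f x) (funext φ.map_δ)
  map_bd v := by
    refine (Hom.differential_comp H.bd φ.mapG v).symm.trans
      (Eq.trans ?_ (Hom.differential_comp φ.mapE K.bd v))
    exact congrArg (fun f : H.E → K.G => differential f v) (funext φ.map_bd)
  map_actE := mixed_natural H.smooth_actE K.smooth_actE (by simp) (by simp) φ.mapG.hasDerivOne
    φ.mapE.hasDerivOne φ.mapE.hasDerivOne (map_one _) (map_one _) φ.map_actE
  map_actL := mixed_natural H.smooth_actL K.smooth_actL (by simp) (by simp) φ.mapG.hasDerivOne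
    φ.mapL.hasDerivOne φ.mapL.hasDerivOne (map_one _) (map_one _) φ.map_actL
  map_lift := mixed_natural H.smooth_lift K.smooth_lift H.lift_one_right K.lift_one_right
    φ.mapE.hasDerivOne φ.mapE.hasDerivOne φ.mapL.hasDerivOne (map_one _) (map_one _) φ.map_lift

/-- The differential 2-crossed module of a 2-crossed module of Lie groups, as a functor. -/
noncomputable def differentialFunctor :
    LieTwoCrossedModule.{v, u} ⥤ DifferentialTwoCrossedModule.{v} where
  obj H := DifferentialTwoCrossedModule.of H.toDifferential
  map φ := Hom.toDifferential φ
  map_id _ := DifferentialTwoCrossedModule.Hom.ext (LieHom.ext Hom.differential_id)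
    (LieHom.ext Hom.differential_id) (LieHom.ext Hom.differential_id)
  map_comp φ ψ := DifferentialTwoCrossedModule.Hom.ext
    (LieHom.ext (Hom.differential_comp φ.mapL ψ.mapL))
    (LieHom.ext (Hom.differential_comp φ.mapE ψ.mapE))
    (LieHom.ext (Hom.differential_comp φ.mapG ψ.mapG))

end LieTwoCrossedModule

theorem mainTheorem9 :
    ∃ (D : ∀ H : LieTwoCrossedModule.{v, u},
        DifferentialTwoCrossedStructure H.L.lieAlg H.E.lieAlg H.G.lieAlg)
      (d : ∀ {H K : LieTwoCrossedModule.{v, u}}, (H ⟶ K) →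
        (DifferentialTwoCrossedModule.of (D H) ⟶ DifferentialTwoCrossedModule.of (D K))),
      (∀ H : LieTwoCrossedModule.{v, u}, H.IsInduced (D H)) ∧
      (∀ {H K : LieTwoCrossedModule.{v, u}} (φ : H ⟶ K),
        (∀ x, (d φ).mapL x = LieGrp.differential φ.mapL x) ∧
        (∀ v, (d φ).mapE v = LieGrp.differential φ.mapE v) ∧
        (∀ X, (d φ).mapG X = LieGrp.differential φ.mapG X)) ∧
      ∃ F : LieTwoCrossedModule.{v, u} ⥤ DifferentialTwoCrossedModule.{v},
        F.toPrefunctor =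
          { obj := fun H => DifferentialTwoCrossedModule.of (D H)
            map := fun φ => d φ } :=
  ⟨fun H => H.toDifferential, fun φ => LieTwoCrossedModule.Hom.toDifferential φ,
    fun H => H.isInduced_toDifferential, fun _ => ⟨fun _ => rfl, fun _ => rfl, fun _ => rfl⟩,
    LieTwoCrossedModule.differentialFunctor, rfl⟩
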